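/- All graphs are finite and simple. The connectivity $\kappa(G)$ of a graph $G$ is the minimum number of vertices whose removal results in a disconnected graph or in a trivial graph (one with at most one vertex). A graph $G$ is minimally $2$-connected if $\kappa(G)\ge 2$ but $\kappa(G-e)<2$ for every edge $e$ of $G$. The spectral radius $\rho(G)$ is the largest eigenvalue of the adjacency matrix of $G$. For $n\ge 1$, let $SK_{2,n}$ denote the graph obtained from the complete bipartite graph $K_{2,n}$ by subdividing one edge once (the result does not depend on the edge, up to isomorphism). **Theorem 1.1.** Let $G$ be a minimally $2$-connected graph with $m$ edges. (i) If $m$ is even, then $\rho(G)\le\sqrt{m}$, and equality holds if and only if $G\cong K_{2,m/2}$. (ii) If $m$ is odd and $m\ge 9$, then $\rho(G)\le\rho_1^*(m)$, where $\rho_1^*(m)$ is the largest real root of $x^3-x^2-(m-2)x+m-3=0$, and equality holds if and only if $G\cong SK_{2,(m-1)/2}$. -/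

import Mathlib

namespace SimpleGraph

/-- Removing the vertices of `S` from `G` leaves a disconnected graph or a trivial one
(at most one vertex). -/
def IsVertexCut {V : Type*} (G : SimpleGraph V) (S : Finset V) : Prop :=
  ¬ (G.induce {v | v ∉ S}).Preconnected ∨ {v | v ∉ S}.Subsingleton

/-- The vertex-connectivity `κ(G)` of a finite graph: the minimum number of vertices whose removal
results in a disconnected graph or in a trivial graph. -/
noncomputable def vertexConnectivity {V : Type*} [Fintype V] (G : SimpleGraph V) : ℕ :=
  sInf {k | ∃ S : Finset V, S.card = k ∧ G.IsVertexCut S}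

/-- `G` is `k`-connected: its vertex-connectivity is at least `k`. -/
def IsKConnected {V : Type*} [Fintype V] (k : ℕ) (G : SimpleGraph V) : Prop :=
  k ≤ G.vertexConnectivity

/-- `G` is `k`-connected iff no vertex set with fewer than `k` elements is a cut. -/
theorem isKConnected_iff {V : Type*} [Fintype V] (k : ℕ) (G : SimpleGraph V) :
    G.IsKConnected k ↔ ∀ S : Finset V, G.IsVertexCut S → k ≤ S.card := by
  have hne : {k | ∃ S : Finset V, S.card = k ∧ G.IsVertexCut S}.Nonempty :=
    ⟨_, Finset.univ, rfl, Or.inr fun x hx => absurd (Finset.mem_univ x) hx⟩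
  constructor
  · intro h S hS
    exact le_trans h (Nat.sInf_le ⟨S, rfl, hS⟩)
  · intro h
    obtain ⟨S, hc, hS⟩ := Nat.sInf_mem hne
    exact le_of_le_of_eq (h S hS) hc

/-- `G` is minimally `k`-connected: it is `k`-connected, and omitting any edge gives a graph that is
not `k`-connected. -/
def IsMinimallyKConnected {V : Type*} [Fintype V] (k : ℕ) (G : SimpleGraph V) : Prop :=
  G.IsKConnected k ∧ ∀ e ∈ G.edgeSet, ¬ (G.deleteEdges {e}).IsKConnected k

/-- The spectral radius `ρ(G)`: the largest (real) eigenvalue of the adjacency matrix of `G`. -/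
noncomputable def rho {V : Type*} [Fintype V] [DecidableEq V] (G : SimpleGraph V)
    [DecidableRel G.Adj] : ℝ :=
  sSup {μ : ℝ | Module.End.HasEigenvalue (Matrix.toLin' (G.adjMatrix ℝ)) μ}

/-- The supremum defining `ρ(G)` is attained: it is the largest eigenvalue. -/
theorem isGreatest_rho {V : Type*} [Fintype V] [DecidableEq V] [Nonempty V] (G : SimpleGraph V)
    [DecidableRel G.Adj] :
    IsGreatest {μ : ℝ | Module.End.HasEigenvalue (Matrix.toLin' (G.adjMatrix ℝ)) μ} G.rho := by
  have hA : (G.adjMatrix ℝ).IsHermitian := by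
    rw [Matrix.IsHermitian, Matrix.conjTranspose_eq_transpose_of_trivial]
    exact G.isSymm_adjMatrix
  have hs : {μ : ℝ | Module.End.HasEigenvalue (Matrix.toLin' (G.adjMatrix ℝ)) μ}
      = Set.range hA.eigenvalues := by
    rw [← hA.spectrum_real_eq_range_eigenvalues, ← Matrix.spectrum_toLin']
    ext μ
    exact Module.End.hasEigenvalue_iff_mem_spectrum
  have hf : {μ : ℝ | Module.End.HasEigenvalue (Matrix.toLin' (G.adjMatrix ℝ)) μ}.Finite := by
    rw [hs]; exact Set.finite_range _
  have hn : {μ : ℝ | Module.End.HasEigenvalue (Matrix.toLin' (G.adjMatrix ℝ)) μ}.Nonempty := by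
    rw [hs]; exact Set.range_nonempty _
  exact ⟨hn.csSup_mem hf, fun μ hμ => le_csSup hf.bddAbove hμ⟩

/-- The graph obtained from `G` by subdividing `e` once (meant for an edge `e` of `G`): `e` is
deleted, and a new vertex `none` is joined to the two ends of `e`. -/
def subdivideEdge {V : Type*} (G : SimpleGraph V) (e : Sym2 V) : SimpleGraph (Option V) where
  Adj
    | some a, some b => (G.deleteEdges {e}).Adj a b
    | some a, none => a ∈ e
    | none, some b => b ∈ e
    | none, none => False
  symm := ⟨by
    rintro (_ | a) (_ | b) h
    · exact h
    · exact h
    · exact h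
    · exact (G.deleteEdges {e}).symm.symm _ _ h⟩
  loopless := ⟨by
    rintro (_ | a) h
    · exact h
    · exact (G.deleteEdges {e}).loopless.irrefl a h⟩

end SimpleGraph

/-! ### Cuts, forbidden chords and triangles in minimally 2-connected graphs. -/

namespace SimpleGraph

variable {V : Type*} {G : SimpleGraph V}

/-! Scale a nonnegative eigenvector `y` for ρ so that its maximum is 1, attained at `u`, and let W
be the set of non-neighbours of `u` other than `u`. A minimally 2-connected graph with m ≠ 3 edges
has no triangles. Writing c(w) for the number of common neighbours of w and `u`, counting walks of
length two from `u` gives ρ² = d(u) + Σ_W c(w) y(w), while m = d(u) + Σ_W c(w) + e(W). Hence ρ² = m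
− e(W) − Σ_W c(w)(1 − y(w)) ≤ m − e(W).

So ρ ≤ √m, and equality forces e(W) = 0. Minimality then forces K_{2,n}
(`nonempty_iso_of_nonneighbors_independent`).

For m odd, K_{2,n} is impossible, so e(W) ≥ 1. The cubic is (x − 1)(x² − (m − 2)) = 1; if ρ is at
least its largest root, then ρ² > m − 2, so W spans a single edge ab. Adding the eigenvalue
equations at a and b and comparing with the one at `u` gives (ρ − 1)(y(a) + y(b)) ≤ ρ. As c(a), c(b)
≥ 1, it follows that ρ² ≤ m − 3 + y(a) + y(b) ≤ m − 2 + 1/(ρ − 1), the cubic inequality reversed.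
Every estimate is therefore tight, and this identifies G as SK_{2,n}. Explicit positive eigenvectors
give ρ for both extremal graphs.

The combinatorial input is that an edge xy cannot be accompanied by two internally disjoint x–y
paths avoiding it: 2-connectedness would survive its deletion. Only path lengths 3, 3 and 3, 4 are
needed. -/

theorem Reachable.mem_of_closed {a b : V} (h : G.Reachable a b) {A : Set V}
    (hA : ∀ p ∈ A, ∀ q, G.Adj p q → q ∈ A) (ha : a ∈ A) : b ∈ A := by
  obtain ⟨w⟩ := h
  induction w with
  | nil => exact ha
  | cons h _ ih => exact ih (hA _ ha _ h)

theorem IsKConnected.two_lt_card [Fintype V] (hG : G.IsKConnected 2) : 2 < Fintype.card V := by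
  classical
  rw [isKConnected_iff] at hG
  by_contra h
  rcases isEmpty_or_nonempty V with hV | ⟨⟨x⟩⟩
  · have := hG ∅ (Or.inr fun a => hV.elim a)
    simp at this
  · have := hG {x} (Or.inr ?_)
    · simp at this
    · intro a ha b hb
      simp only [Finset.mem_singleton, Set.mem_ofPred_eq] at ha hb
      by_contra hab
      have h3 : ({x, a, b} : Finset V).card = 3 := by
        rw [Finset.card_eq_three]
        exact ⟨x, a, b, fun h => ha h.symm, fun h => hb h.symm, hab, rfl⟩
      have := Finset.card_le_univ ({x, a, b} : Finset V)
      omega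

theorem IsKConnected.not_separates [Fintype V] (hG : G.IsKConnected 2) {S : Finset V}
    (hS : S.card < 2) {a b : V} {A : Set V}
    (hA : ∀ p ∈ A, ∀ q ∉ A, p ∉ S → q ∉ S → ¬ G.Adj p q)
    (ha : a ∈ A) (hax : a ∉ S) (hb : b ∉ A) (hbx : b ∉ S) : False := by
  classical
  rw [isKConnected_iff] at hG
  have h : (G.induce {v | v ∉ S}).Preconnected := by
    by_contra h
    exact absurd (hG S (Or.inl h)) (by omega)
  refine hb ((h ⟨a, hax⟩ ⟨b, hbx⟩).mem_of_closed (A := {z | z.1 ∈ A}) ?_ ha)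
  rintro ⟨p, hp⟩ hpA ⟨q, hq⟩ hpq
  by_contra hqA
  exact hA p hpA q hqA hp hq hpq

theorem IsKConnected.not_separates_vertex [Fintype V] (hG : G.IsKConnected 2) {x a b : V}
    {A : Set V} (hA : ∀ p ∈ A, ∀ q ∉ A, p ≠ x → q ≠ x → ¬ G.Adj p q)
    (ha : a ∈ A) (hax : a ≠ x) (hb : b ∉ A) (hbx : b ≠ x) : False :=
  hG.not_separates (S := {x}) (by simp) (by simpa using hA) ha (by simpa using hax) hb
    (by simpa using hbx)

theorem exists_ne_ne_of_two_lt_card [Fintype V] (h : 2 < Fintype.card V) (x y : V) :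
    ∃ z, z ≠ x ∧ z ≠ y := by
  classical
  obtain ⟨z, -, hz⟩ := Finset.exists_mem_notMem_of_card_lt_card
    (s := {x, y}) (t := Finset.univ) (by
      rw [Finset.card_univ]; exact lt_of_le_of_lt Finset.card_le_two h)
  exact ⟨z, by simpa using hz⟩

/-- Otherwise deleting `x` would isolate `v`. Taking `x = v` just yields some neighbour. -/
theorem IsKConnected.exists_adj_ne [Fintype V] (hG : G.IsKConnected 2) (v x : V) :
    ∃ w, G.Adj v w ∧ w ≠ x := by
  by_contra! h
  have key : ∀ x, x ≠ v → (∀ w, G.Adj v w → w = x) → False := by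
    intro x hx h
    obtain ⟨z, hz, hz'⟩ := exists_ne_ne_of_two_lt_card hG.two_lt_card v x
    refine hG.not_separates_vertex (x := x) (A := {v}) (a := v) (b := z) ?_ rfl hx.symm hz hz'
    rintro p rfl q - - hq hpq
    exact hq (h q hpq)
  by_cases hx : x = v
  · obtain ⟨z, hz, -⟩ := exists_ne_ne_of_two_lt_card hG.two_lt_card v v
    refine key z hz fun w hw => ?_
    exact absurd ((h w hw).trans hx) hw.ne'
  · exact key x hx h

/-- In a minimally 2-connected graph, each edge is, after removal of a suitable vertex, the only
edge across some bipartition of the remaining vertices. -/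
theorem IsMinimallyKConnected.exists_cut [Fintype V] (hG : G.IsMinimallyKConnected 2) {x y : V}
    (hxy : G.Adj x y) :
    ∃ v : V, ∃ A : Set V, v ≠ x ∧ v ≠ y ∧ x ∈ A ∧ y ∉ A ∧
      ∀ p ∈ A, ∀ q ∉ A, p ≠ v → q ≠ v → G.Adj p q → p = x ∧ q = y := by
  classical
  obtain ⟨h2, hmin⟩ := hG
  have hcard := h2.two_lt_card
  have he := hmin s(x, y) hxy
  rw [isKConnected_iff] at he
  push Not at he
  obtain ⟨S, hcut, hS⟩ := he
  have hne : ¬ {v | v ∉ S}.Subsingleton := by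
    intro h
    have h2' := (isKConnected_iff 2 G).1 h2 S (Or.inr h)
    omega
  have hnc := hcut.resolve_right hne
  unfold Preconnected at hnc
  push Not at hnc
  obtain ⟨⟨p, hp⟩, ⟨q, hq⟩, hpq⟩ := hnc
  set H := (G.deleteEdges {s(x, y)}).induce {v | v ∉ S} with hH
  let A : Set V := {z | ∃ hz : z ∉ S, H.Reachable ⟨p, hp⟩ ⟨z, hz⟩}
  have hpA : p ∈ A := ⟨hp, Reachable.refl _⟩
  have hqA : q ∉ A := fun ⟨_, h⟩ => hpq h
  have hcross : ∀ a ∈ A, ∀ b ∉ A, a ∉ S → b ∉ S → G.Adj a b → s(a, b) = s(x, y) := by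
    rintro a ⟨ha, hra⟩ b hb - hbS hab
    by_contra hne
    refine hb ⟨hbS, hra.trans (Adj.reachable ?_)⟩
    simp [hH, hab]
    simpa using hne
  have hex : ∃ a ∈ A, ∃ b ∉ A, a ∉ S ∧ b ∉ S ∧ G.Adj a b := by
    by_contra! h
    exact h2.not_separates hS h hpA hp hqA hq
  obtain ⟨v, hvx, hvy, hSv⟩ : ∃ v, v ≠ x ∧ v ≠ y ∧ ∀ z ∈ S, z = v := by
    obtain ⟨a, haA, b, hbA, haS, hbS, hab⟩ := hex
    have h := hcross a haA b hbA haS hbS hab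
    -- When `S` is empty, any vertex other than `x` and `y` can serve as `v`.
    rcases S.eq_empty_or_nonempty with rfl | ⟨v, hv⟩
    · obtain ⟨z, hz, hz'⟩ := exists_ne_ne_of_two_lt_card hcard x y
      exact ⟨z, hz, hz', by simp⟩
    · have hx : x ∉ S ∧ y ∉ S := by
        rcases Sym2.eq_iff.1 h with ⟨rfl, rfl⟩ | ⟨rfl, rfl⟩ <;> exact ⟨by assumption, by assumption⟩
      refine ⟨v, fun h => hx.1 (h ▸ hv), fun h => hx.2 (h ▸ hv), fun z hz => ?_⟩
      exact Finset.card_le_one.1 (by omega) z hz v hv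
  have hS' : ∀ z, z ≠ v → z ∉ S := fun z hz h => hz (hSv z h)
  obtain ⟨a, haA, b, hbA, haS, hbS, hab⟩ := hex
  rcases Sym2.eq_iff.1 (hcross a haA b hbA haS hbS hab) with ⟨rfl, rfl⟩ | ⟨rfl, rfl⟩
  · refine ⟨v, A, hvx, hvy, haA, hbA, fun p hp q hq hpv hqv h => ?_⟩
    rcases Sym2.eq_iff.1 (hcross p hp q hq (hS' p hpv) (hS' q hqv) h) with h | ⟨rfl, rfl⟩
    · exact h
    · exact absurd hp hbA
  · refine ⟨v, Aᶜ, hvx, hvy, hbA, fun h => h haA, fun p hp q hq hpv hqv h => ?_⟩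
    rw [Set.mem_compl_iff, not_not] at hq
    rcases Sym2.eq_iff.1 (hcross q hq p hp (hS' q hqv) (hS' p hpv) h.symm) with ⟨rfl, rfl⟩ | h
    · exact absurd hq hbA
    · exact ⟨h.2, h.1⟩

/-- The vertex `v` that separates `x` from `y` once the edge is gone meets at most one of the paths
x–a–b–y and x–c–d–y; the other crosses the cut by a second edge. -/
theorem IsMinimallyKConnected.two_paths_three_three [Fintype V] (hG : G.IsMinimallyKConnected 2)
    {x y a b c d : V} (hxy : G.Adj x y) (h1 : G.Adj x a) (h2 : G.Adj a b) (h3 : G.Adj b y)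
    (h4 : G.Adj x c) (h5 : G.Adj c d) (h6 : G.Adj d y) (hac : a ≠ c) (had : a ≠ d) (hbc : b ≠ c)
    (hbd : b ≠ d) (hay : a ≠ y) (hcy : c ≠ y) (hbx : b ≠ x) (hdx : d ≠ x) : False := by
  obtain ⟨v, A, hvx, hvy, hx, hy, h⟩ := hG.exists_cut hxy
  have step : ∀ p q, G.Adj p q → p ∈ A → p ≠ v → q ≠ v → (p = x → q ≠ y) → q ∈ A :=
    fun p q hpq hp hpv hqv hne => by_contra fun hq =>
      have hpq' := h p hp q hq hpv hqv hpq
      hne hpq'.1 hpq'.2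
  by_cases hv : a = v ∨ b = v
  · have hcv : c ≠ v := by grind
    have hdv : d ≠ v := by grind
    have hc := step x c h4 hx hvx.symm hcv fun _ => hcy
    have hd := step c d h5 hc hcv hdv fun hcx => absurd hcx h4.ne'
    exact hy (step d y h6 hd hdv hvy.symm fun h => absurd h hdx)
  · push Not at hv
    have ha := step x a h1 hx hvx.symm hv.1 fun _ => hay
    have hb := step a b h2 ha hv.1 hv.2 fun hax => absurd hax h1.ne'
    exact hy (step b y h3 hb hv.2 hvy.symm fun h => absurd h hbx)

theorem IsMinimallyKConnected.two_paths_three_four [Fintype V] (hG : G.IsMinimallyKConnected 2)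
    {x y a b c d e : V} (hxy : G.Adj x y) (h1 : G.Adj x a) (h2 : G.Adj a b) (h3 : G.Adj b y)
    (h4 : G.Adj x c) (h5 : G.Adj c d) (h6 : G.Adj d e) (h7 : G.Adj e y)
    (hac : a ≠ c) (had : a ≠ d) (hae : a ≠ e) (hbc : b ≠ c) (hbd : b ≠ d) (hbe : b ≠ e)
    (hay : a ≠ y) (hcy : c ≠ y) (hbx : b ≠ x) (hdx : d ≠ x) (hex : e ≠ x) : False := by
  obtain ⟨v, A, hvx, hvy, hx, hy, h⟩ := hG.exists_cut hxy
  have step : ∀ p q, G.Adj p q → p ∈ A → p ≠ v → q ≠ v → (p = x → q ≠ y) → q ∈ A :=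
    fun p q hpq hp hpv hqv hne => by_contra fun hq =>
      have hpq' := h p hp q hq hpv hqv hpq
      hne hpq'.1 hpq'.2
  by_cases hv : a = v ∨ b = v
  · have hcv : c ≠ v := by grind
    have hdv : d ≠ v := by grind
    have hev : e ≠ v := by grind
    have hc := step x c h4 hx hvx.symm hcv fun _ => hcy
    have hd := step c d h5 hc hcv hdv fun hcx => absurd hcx h4.ne'
    have he := step d e h6 hd hdv hev fun h => absurd h hdx
    exact hy (step e y h7 he hev hvy.symm fun h => absurd h hex)
  · push Not at hv
    have ha := step x a h1 hx hvx.symm hv.1 fun _ => hay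
    have hb := step a b h2 ha hv.1 hv.2 fun hax => absurd hax h1.ne'
    exact hy (step b y h3 hb hv.2 hvy.symm fun h => absurd h hbx)

/-- The cut vertex for the edge xy must be `z`, and the one for xz must be `y`, since the rest of
the triangle is a detour. If `x` had a further neighbour `t`, it would lie on the `x`-side of both
cuts, and the intersection of these sides, without `y` and `z`, can be left only through `x`. -/
theorem IsMinimallyKConnected.eq_or_eq_of_triangle [Fintype V] (hG : G.IsMinimallyKConnected 2)
    {x y z t : V} (hxy : G.Adj x y) (hyz : G.Adj y z) (hxz : G.Adj x z) (ht : G.Adj x t) :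
    t = y ∨ t = z := by
  by_contra! hne
  obtain ⟨v, A, hvx, hvy, hx, hy, h⟩ := hG.exists_cut hxy
  obtain ⟨v', A', hvx', hvz', hx', hz', h'⟩ := hG.exists_cut hxz
  have hv : v = z := by
    by_contra hv
    grind [hyz.symm, hyz.ne]
  have hv' : v' = y := by
    by_contra hv
    grind [hyz.ne]
  subst hv hv'
  refine hG.1.not_separates_vertex (x := x) (A := {p | p ∈ A ∧ p ∈ A' ∧ p ≠ v ∧ p ≠ v'})
    (a := t) (b := v) ?_ ?_ ht.ne' (by simp) hvx
  · rintro p ⟨hp, hp', hpv, hpv'⟩ q hq hpx hqx hpq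
    simp only [Set.mem_ofPred_eq] at hq
    grind
  · have := ht.ne
    refine ⟨?_, ?_, hne.2, hne.1⟩ <;> by_contra hA <;> grind

theorem IsMinimallyKConnected.card_eq_three_of_triangle [Fintype V]
    (hG : G.IsMinimallyKConnected 2) {x y z : V} (hxy : G.Adj x y) (hyz : G.Adj y z)
    (hxz : G.Adj x z) [Fintype G.edgeSet] : G.edgeFinset.card = 3 := by
  classical
  have hV : ∀ t, t = x ∨ t = y ∨ t = z := by
    by_contra! h
    obtain ⟨t, htx, hty, htz⟩ := h
    refine hG.1.not_separates (S := ∅) (A := {x, y, z}) (a := x) (b := t) (by simp) ?_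
      (by simp) (by simp) (by simp [*]) (by simp)
    rintro p hp q hq - - hpq
    have h1 : ∀ t, G.Adj x t → t = y ∨ t = z := fun t => hG.eq_or_eq_of_triangle hxy hyz hxz
    have h2 : ∀ t, G.Adj y t → t = x ∨ t = z := fun t =>
      hG.eq_or_eq_of_triangle hxy.symm hxz hyz
    have h3 : ∀ t, G.Adj z t → t = x ∨ t = y := fun t =>
      hG.eq_or_eq_of_triangle hxz.symm hxy hyz.symm
    simp only [Set.mem_insert_iff, Set.mem_singleton_iff] at hp hq
    grind
  have : G.edgeFinset = {s(x, y), s(y, z), s(x, z)} := by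
    ext e
    induction e with
    | _ p q =>
      have := hxy.symm; have := hyz.symm; have := hxz.symm
      have := G.loopless.irrefl x; have := G.loopless.irrefl y; have := G.loopless.irrefl z
      simp only [mem_edgeFinset, mem_edgeSet, Finset.mem_insert, Finset.mem_singleton, Sym2.eq_iff]
      rcases hV p with rfl | rfl | rfl <;> rcases hV q with rfl | rfl | rfl <;> grind
  rw [this, Finset.card_eq_three]
  have := hxy.ne; have := hyz.ne; have := hxz.ne
  exact ⟨_, _, _, by simp; grind, by simp; grind, by simp; grind, rfl⟩

theorem IsMinimallyKConnected.triangleFree [Fintype V] (hG : G.IsMinimallyKConnected 2)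
    [Fintype G.edgeSet] (hm : G.edgeFinset.card ≠ 3) (x y z : V) (hxy : G.Adj x y)
    (hyz : G.Adj y z) : ¬ G.Adj x z :=
  fun hxz => hm (hG.card_eq_three_of_triangle hxy hyz hxz)

theorem IsKConnected.nonempty [Fintype V] (hG : G.IsKConnected 2) : Nonempty V :=
  Fintype.card_pos_iff.1 (by have := hG.two_lt_card; omega)

end SimpleGraph

/-! ### Recognising K_{2,n} and SK_{2,n}. -/

namespace SimpleGraph

variable {V : Type*} {G : SimpleGraph V}

theorem nonempty_iso_completeBipartiteGraph_two [Fintype V] {s t : V} (hst : s ≠ t)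
    (hnst : ¬ G.Adj s t) (h : ∀ v, v ≠ s → v ≠ t → G.Adj s v ∧ G.Adj t v)
    (hind : ∀ v w, v ≠ s → v ≠ t → w ≠ s → w ≠ t → ¬ G.Adj v w) :
    ∃ n, Nonempty (G ≃g completeBipartiteGraph (Fin 2) (Fin n)) := by
  classical
  let n := Fintype.card {v // v ≠ s ∧ v ≠ t}
  let e : {v // v ≠ s ∧ v ≠ t} ≃ Fin n := Fintype.equivFin _
  let f : Fin 2 ⊕ Fin n → V := Sum.elim ![s, t] fun k => e.symm k
  have hk : ∀ k, (e.symm k : V) ≠ s ∧ (e.symm k : V) ≠ t := fun k => (e.symm k).2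
  have hf : Function.Bijective f := by
    constructor
    · rintro (i | i) (j | j) hij
      · fin_cases i <;> fin_cases j <;> simp [f, hst, hst.symm] at hij ⊢
      · fin_cases i <;> simp [f, (hk _).1.symm, (hk _).2.symm] at hij
      · fin_cases j <;> simp [f, hk] at hij
      · simp only [f, Sum.elim_inr] at hij
        rw [e.symm.injective (Subtype.ext hij)]
    · intro v
      by_cases hs : v = s
      · exact ⟨Sum.inl 0, by simp [f, hs]⟩
      by_cases ht : v = t
      · exact ⟨Sum.inl 1, by simp [f, ht]⟩
      exact ⟨Sum.inr (e ⟨v, hs, ht⟩), by simp [f]⟩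
  refine ⟨n, ⟨RelIso.symm ⟨Equiv.ofBijective f hf, ?_⟩⟩⟩
  have hnts : ¬ G.Adj t s := fun h => hnst h.symm
  have h1 : ∀ k, G.Adj s (e.symm k) := fun k => (h _ (hk k).1 (hk k).2).1
  have h2 : ∀ k, G.Adj t (e.symm k) := fun k => (h _ (hk k).1 (hk k).2).2
  rintro (i | i) (j | j)
  · fin_cases i <;> fin_cases j <;> simp [f, hnst, hnts]
  · fin_cases i <;> simp [f, h1, h2]
  · fin_cases j <;> simp [f, (h1 _).symm, (h2 _).symm]
  · simpa [f] using hind _ _ (hk i).1 (hk i).2 (hk j).1 (hk j).2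

/-- The vertices `u` and `a` form the side of size two, and `b` is the vertex subdividing the edge
aq. -/
theorem nonempty_iso_subdivideEdge [Fintype V] {u a b q : V} {n : ℕ}
    (hua : u ≠ a) (hub : u ≠ b) (hab : a ≠ b) (hq : q ≠ u ∧ q ≠ a ∧ q ≠ b)
    (hu : ∀ z, G.Adj u z ↔ z ≠ u ∧ z ≠ a ∧ z ≠ b)
    (ha : ∀ z, G.Adj a z ↔ z = b ∨ (z ≠ u ∧ z ≠ a ∧ z ≠ b ∧ z ≠ q))
    (hb : ∀ z, G.Adj b z ↔ z = a ∨ z = q)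
    (hind : ∀ v w, G.Adj u v → G.Adj u w → ¬ G.Adj v w)
    (hn : Nat.card {z // z ≠ u ∧ z ≠ a ∧ z ≠ b} = n) :
    ∃ e ∈ (completeBipartiteGraph (Fin 2) (Fin n)).edgeSet,
      Nonempty (G ≃g (completeBipartiteGraph (Fin 2) (Fin n)).subdivideEdge e) := by
  classical
  let e : {z // z ≠ u ∧ z ≠ a ∧ z ≠ b} ≃ Fin n := Finite.equivFinOfCardEq hn
  let j₀ := e ⟨q, hq⟩
  have hj₀ : ∀ k, (e.symm k : V) = q ↔ k = j₀ := fun k => by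
    rw [← e.symm_apply_eq, ← Subtype.coe_inj]
  refine ⟨s(Sum.inl 1, Sum.inr j₀), by simp, ?_⟩
  let f : Option (Fin 2 ⊕ Fin n) → V := fun o =>
    o.elim b (Sum.elim ![u, a] fun k => e.symm k)
  have hk : ∀ k, (e.symm k : V) ≠ u ∧ (e.symm k : V) ≠ a ∧ (e.symm k : V) ≠ b :=
    fun k => (e.symm k).2
  have hf : Function.Bijective f := by
    constructor
    · rintro (_ | i | i) (_ | j | j) hij
      · rfl
      · fin_cases j <;> simp [f, hub.symm, hab.symm] at hij
      · exact absurd hij.symm (hk j).2.2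
      · fin_cases i <;> simp [f, hub, hab] at hij
      · fin_cases i <;> fin_cases j <;> simp [f, hua, hua.symm] at hij ⊢
      · fin_cases i <;> simp [f, (hk _).1.symm, (hk _).2.1.symm] at hij
      · exact absurd hij (hk i).2.2
      · fin_cases j <;> simp [f, hk] at hij
      · simp only [f, Option.elim_some, Sum.elim_inr] at hij
        rw [e.symm.injective (Subtype.ext hij)]
    · intro v
      by_cases h1 : v = u
      · exact ⟨some (Sum.inl 0), by simp [f, h1]⟩
      by_cases h2 : v = a
      · exact ⟨some (Sum.inl 1), by simp [f, h2]⟩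
      by_cases h3 : v = b
      · exact ⟨none, by simp [f, h3]⟩
      exact ⟨some (Sum.inr (e ⟨v, h1, h2, h3⟩)), by simp [f]⟩
  refine ⟨RelIso.symm ⟨Equiv.ofBijective f hf, ?_⟩⟩
  have h1 : ∀ k, G.Adj u (e.symm k) := fun k => (hu _).2 (hk k)
  have h2 : ∀ k, G.Adj a (e.symm k) ↔ k ≠ j₀ := fun k => by
    have := hk k; have := hj₀ k; rw [ha]; tauto
  have h3 : ∀ k, G.Adj b (e.symm k) ↔ k = j₀ := fun k => by
    have := hk k; have := hj₀ k; rw [hb]; tauto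
  have h4 : G.Adj a b := (ha b).2 (Or.inl rfl)
  have h5 : ¬ G.Adj u a := fun h => ((hu a).1 h).2.1 rfl
  have h6 : ¬ G.Adj u b := fun h => ((hu b).1 h).2.2 rfl
  have h5' : ¬ G.Adj a u := fun h => h5 h.symm
  have h6' : ¬ G.Adj b u := fun h => h6 h.symm
  rintro (_ | i | i) (_ | j | j)
  · simp [f, subdivideEdge]
  · fin_cases j <;> simp [f, subdivideEdge, h6', h4.symm]
  · simp [f, subdivideEdge, h3]
  · fin_cases i <;> simp [f, subdivideEdge, h6, h4]
  · fin_cases i <;> fin_cases j <;> simp [f, subdivideEdge, h5, h5']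
  · fin_cases i <;> simp [f, subdivideEdge, h1, h2]
  · simp [f, subdivideEdge, G.adj_comm _ b, h3]
  · fin_cases j <;> simp [f, subdivideEdge, G.adj_comm _ a, G.adj_comm _ u, h1, h2]
  · simp [f, subdivideEdge, hind _ _ (h1 i) (h1 j)]

/-- The graph is bipartite between N(u) and its complement. If `u` has one further non-neighbour,
that vertex and `u` are the side of size two. If it has several, all of them and `u` have the same
two neighbours, which form that side. -/
theorem IsMinimallyKConnected.nonempty_iso_of_nonneighbors_independent [Fintype V]
    (hG : G.IsMinimallyKConnected 2)
    (hT : ∀ x y z, G.Adj x y → G.Adj y z → ¬ G.Adj x z) {u : V}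
    (hW : ∀ a b, ¬ G.Adj u a → ¬ G.Adj u b → ¬ G.Adj a b) :
    ∃ n, Nonempty (G ≃g completeBipartiteGraph (Fin 2) (Fin n)) := by
  have hN : ∀ a v, ¬ G.Adj u a → G.Adj a v → G.Adj u v := fun a v ha hav =>
    by_contra fun hv => hW a v ha hv hav
  have hback : ∀ v, G.Adj u v → ∃ w, G.Adj v w ∧ w ≠ u ∧ ¬ G.Adj u w := fun v hv => by
    obtain ⟨w, hvw, hw⟩ := hG.1.exists_adj_ne v u
    exact ⟨w, hvw, hw, hT u v w hv hvw⟩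
  -- If v₂ ≠ v₃, the edge uv has the disjoint detours u–v₂–a–v and u–v₃–b–v.
  have hsdr : ∀ a b v v₂ v₃, a ≠ u → ¬ G.Adj u a → b ≠ u → ¬ G.Adj u b → a ≠ b →
      G.Adj a v → G.Adj b v → G.Adj a v₂ → v₂ ≠ v → G.Adj b v₃ → v₃ ≠ v → v₂ = v₃ := by
    intro a b v v₂ v₃ hau ha hbu hb hab hav hbv hav₂ h₂ hbv₃ h₃
    by_contra hne
    have hu₂ := hN a v₂ ha hav₂
    have hu₃ := hN b v₃ hb hbv₃
    exact hG.two_paths_three_three (hN a v ha hav) hu₂ hav₂.symm hav hu₃ hbv₃.symm hbv hne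
      (fun h => hb (h ▸ hu₂)) (fun h => ha (h ▸ hu₃)) hab h₂ h₃ hau hbu
  have hsame : ∀ a b v, a ≠ u → ¬ G.Adj u a → b ≠ u → ¬ G.Adj u b → a ≠ b →
      G.Adj a v → G.Adj b v → ∃ v', v' ≠ v ∧ (∀ z, G.Adj a z ↔ z = v ∨ z = v') ∧
        ∀ z, G.Adj b z ↔ z = v ∨ z = v' := by
    intro a b v hau ha hbu hb hab hav hbv
    obtain ⟨v₂, hav₂, h₂⟩ := hG.1.exists_adj_ne a v
    obtain ⟨v₃, hbv₃, h₃⟩ := hG.1.exists_adj_ne b v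
    have h := hsdr a b v
    obtain rfl := h v₂ v₃ hau ha hbu hb hab hav hbv hav₂ h₂ hbv₃ h₃
    refine ⟨v₂, h₂, fun z => ⟨fun hz => ?_, ?_⟩, fun z => ⟨fun hz => ?_, ?_⟩⟩
    · by_cases hzv : z = v
      · exact Or.inl hzv
      · exact Or.inr (h z v₂ hau ha hbu hb hab hav hbv hz hzv hbv₃ h₃)
    · rintro (rfl | rfl) <;> assumption
    · by_cases hzv : z = v
      · exact Or.inl hzv
      · exact Or.inr (h v₂ z hau ha hbu hb hab hav hbv hav₂ h₂ hz hzv).symm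
    · rintro (rfl | rfl) <;> assumption
  have hmeet : ∀ a b, a ≠ u → ¬ G.Adj u a → b ≠ u → ¬ G.Adj u b → ∃ v, G.Adj a v ∧ G.Adj b v := by
    intro a b hau ha hbu hb
    by_contra! hno
    obtain ⟨v₀, hav₀, -⟩ := hG.1.exists_adj_ne a a
    -- By `hsame`, a vertex sharing one neighbour with `a` shares all of them, so N(a) and these
    -- vertices can be left only through `u`.
    refine hG.1.not_separates_vertex (x := u) (a := a) (b := b)
      (A := {z | G.Adj a z ∨ (z ≠ u ∧ ¬ G.Adj u z ∧ ∃ v, G.Adj a v ∧ G.Adj z v)}) ?_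
      (Or.inr ⟨hau, ha, v₀, hav₀, hav₀⟩) hau ?_ hbu
    · rintro p (hp | ⟨hpu, hp, v, hav, hpv⟩) q hq - hqu hpq
      · exact hq (Or.inr ⟨hqu, hT u p q (hN a p ha hp) hpq, p, hp, hpq.symm⟩)
      · refine hq (Or.inl ?_)
        by_cases hap : a = p
        · exact hap ▸ hpq
        · obtain ⟨v', -, h1, h2⟩ := hsame a p v hau ha hpu hp hap hav hpv
          exact (h1 q).2 ((h2 q).1 hpq)
    · rintro (h | ⟨-, -, v, hav, hbv⟩)
      · exact hb (hN a b ha h)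
      · exact hno v hav hbv
  obtain ⟨v₀, huv₀, -⟩ := hG.1.exists_adj_ne u u
  obtain ⟨a, -, hau, ha⟩ := hback v₀ huv₀
  by_cases hone : ∀ b, b ≠ u → ¬ G.Adj u b → b = a
  · refine nonempty_iso_completeBipartiteGraph_two hau.symm ha (fun v hvu hva => ?_)
      fun v w hvu hva hwu hwa hvw => ?_
    · have huv : G.Adj u v := by_contra fun h => hva (hone v hvu h)
      obtain ⟨w, hvw, hwu, hw⟩ := hback v huv
      exact ⟨huv, hone w hwu hw ▸ hvw.symm⟩
    · have huv : G.Adj u v := by_contra fun h => hva (hone v hvu h)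
      have huw : G.Adj u w := by_contra fun h => hwa (hone w hwu h)
      exact hT u v w huv hvw huw
  · push Not at hone
    obtain ⟨b, hbu, hb, hba⟩ := hone
    obtain ⟨v, hav, hbv⟩ := hmeet a b hau ha hbu hb
    obtain ⟨v', hv', hNa, -⟩ := hsame a b v hau ha hbu hb hba.symm hav hbv
    have hNc : ∀ c, c ≠ u → ¬ G.Adj u c → ∀ z, G.Adj c z ↔ z = v ∨ z = v' := by
      intro c hcu hc z
      by_cases hca : c = a
      · rw [hca, hNa]
      · obtain ⟨w, haw, hcw⟩ := hmeet a c hau ha hcu hc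
        obtain ⟨w', -, h1, h2⟩ := hsame a c w hau ha hcu hc (Ne.symm hca) haw hcw
        rw [h2, ← h1, hNa]
    have hNu : ∀ z, G.Adj u z ↔ z = v ∨ z = v' := by
      refine fun z => ⟨fun hz => ?_, ?_⟩
      · obtain ⟨w, hzw, hwu, hw⟩ := hback z hz
        exact (hNc w hwu hw z).1 hzw.symm
      · rintro (rfl | rfl)
        · exact hN a _ ha hav
        · exact hN a _ ha ((hNa _).2 (Or.inr rfl))
    have hall : ∀ z, ¬ G.Adj u z → ∀ x, G.Adj z x ↔ x = v ∨ x = v' := by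
      intro z hz
      by_cases hzu : z = u
      · exact hzu ▸ hNu
      · exact hNc z hzu hz
    refine nonempty_iso_completeBipartiteGraph_two hv'.symm
      (fun h => hT u v v' ((hNu _).2 (Or.inl rfl)) h ((hNu _).2 (Or.inr rfl)))
      (fun z hzv hzv' => ?_) fun z w hzv hzv' hwv hwv' => ?_
    · have hz : ¬ G.Adj u z := by rw [hNu]; tauto
      exact ⟨((hall z hz v).2 (Or.inl rfl)).symm, ((hall z hz v').2 (Or.inr rfl)).symm⟩
    · refine hW z w ?_ ?_ <;> rw [hNu] <;> tauto

theorem card_edgeFinset_of_iso_completeBipartiteGraph_two [Fintype G.edgeSet] {n : ℕ}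
    (h : Nonempty (G ≃g completeBipartiteGraph (Fin 2) (Fin n))) :
    G.edgeFinset.card = 2 * n := by
  classical
  obtain ⟨φ⟩ := h
  have : Fintype (completeBipartiteGraph (Fin 2) (Fin n)).edgeSet := Fintype.ofFinite _
  rw [φ.card_edgeFinset_eq]
  have := encard_edgeSet_completeBipartiteGraph (W₁ := Fin 2) (W₂ := Fin n)
  rw [← coe_edgeFinset, Set.encard_coe_eq_coe_finsetCard] at this
  simp only [ENat.card_eq_coe_fintype_card, Fintype.card_fin] at this
  exact_mod_cast this

end SimpleGraph

/-! ### The spectral radius: Perron vector and explicit eigenvectors. -/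

namespace SimpleGraph

variable {V : Type*} [Fintype V] [DecidableEq V] (G : SimpleGraph V) [DecidableRel G.Adj]

theorem le_rho_of_sum_neighborFinset_eq {z : V → ℝ} {r : ℝ} (hz : z ≠ 0)
    (h : ∀ v, ∑ w ∈ G.neighborFinset v, z w = r * z v) : r ≤ G.rho := by
  have : Nonempty V := by
    by_contra hV
    rw [not_nonempty_iff] at hV
    exact hz (Subsingleton.elim _ _)
  refine G.isGreatest_rho.2 (Module.End.hasEigenvalue_of_hasEigenvector (x := z) ?_)
  rw [Module.End.hasEigenvector_iff, Module.End.mem_eigenspace_iff]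
  refine ⟨?_, hz⟩
  ext v
  simpa [adjMatrix_mulVec_apply] using h v

theorem posSemidef_rho_smul_one_sub_adjMatrix :
    (G.rho • (1 : Matrix V V ℝ) - G.adjMatrix ℝ).PosSemidef := by
  have hM : (G.rho • (1 : Matrix V V ℝ) - G.adjMatrix ℝ).IsHermitian := by
    rw [Matrix.IsHermitian, Matrix.conjTranspose_eq_transpose_of_trivial]
    simp [G.transpose_adjMatrix]
  rw [hM.posSemidef_iff_eigenvalues_nonneg]
  intro i
  have h := hM.mulVec_eigenvectorBasis i
  have h0 : (⇑(hM.eigenvectorBasis i) : V → ℝ) ≠ 0 := fun h0 =>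
    hM.eigenvectorBasis.orthonormal.ne_zero i (by ext v; exact congrFun h0 v)
  have : G.rho - hM.eigenvalues i ≤ G.rho := by
    refine G.le_rho_of_sum_neighborFinset_eq h0 fun v => ?_
    have hv := congrFun h v
    simp only [Matrix.sub_mulVec, Matrix.smul_mulVec, Matrix.one_mulVec, Pi.sub_apply,
      Pi.smul_apply, smul_eq_mul, adjMatrix_mulVec_apply] at hv
    linarith
  simpa using this

/-- For an eigenvector `x` of ρ, passing to |x| does not increase the quadratic form of ρI − A,
which is zero at `x`. That matrix is positive semidefinite, so |x| lies in its kernel. It remains to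
divide by the maximum. -/
theorem exists_perron_vector [Nonempty V] :
    ∃ y : V → ℝ, (∀ v, 0 ≤ y v) ∧ (∀ v, y v ≤ 1) ∧ (∃ u, y u = 1) ∧
      ∀ v, ∑ w ∈ G.neighborFinset v, y w = G.rho * y v := by
  obtain ⟨x, hx⟩ := G.isGreatest_rho.1.exists_hasEigenvector
  rw [Module.End.hasEigenvector_iff, Module.End.mem_eigenspace_iff] at hx
  obtain ⟨hx, hx0⟩ := hx
  have hxv : ∀ v, ∑ w ∈ G.neighborFinset v, x w = G.rho * x v := fun v => by
    simpa [adjMatrix_mulVec_apply] using congrFun hx v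
  set M := G.rho • (1 : Matrix V V ℝ) - G.adjMatrix ℝ with hMdef
  have hM : M.PosSemidef := G.posSemidef_rho_smul_one_sub_adjMatrix
  set z : V → ℝ := fun v => |x v| with hz
  have hMz : ∀ z : V → ℝ, ∀ v, (M.mulVec z) v = G.rho * z v - ∑ w ∈ G.neighborFinset v, z w := by
    intro z v
    simp [hMdef, Matrix.sub_mulVec, Matrix.smul_mulVec, adjMatrix_mulVec_apply]
  have hzero : star z ⬝ᵥ M.mulVec z = 0 := by
    refine le_antisymm ?_ (hM.dotProduct_mulVec_nonneg z)
    have h0 : ∑ v, x v * (G.rho * x v - ∑ w ∈ G.neighborFinset v, x w) = 0 :=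
      Finset.sum_eq_zero fun v _ => by rw [hxv v]; ring
    rw [← h0]
    simp only [dotProduct, star_trivial, hMz]
    refine Finset.sum_le_sum fun v _ => ?_
    rw [mul_sub, mul_sub, Finset.mul_sum, Finset.mul_sum]
    have h1 : z v * (G.rho * z v) = x v * (G.rho * x v) := by
      have := abs_mul_abs_self (x v)
      simp only [hz]
      linear_combination G.rho * this
    have h2 : ∑ w ∈ G.neighborFinset v, x v * x w ≤ ∑ w ∈ G.neighborFinset v, z v * z w :=
      Finset.sum_le_sum fun w _ => by
        simp only [hz]
        rw [← abs_mul]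
        exact le_abs_self _
    linarith
  rw [hM.dotProduct_mulVec_zero_iff] at hzero
  obtain ⟨u, -, hu⟩ := Finset.exists_max_image Finset.univ z Finset.univ_nonempty
  have hzu : 0 < z u := by
    obtain ⟨v, hv⟩ := Function.ne_iff.1 hx0
    exact lt_of_lt_of_le (abs_pos.2 hv) (hu v (Finset.mem_univ v))
  refine ⟨fun v => z v / z u, fun v => div_nonneg (abs_nonneg _) hzu.le,
    fun v => (div_le_one hzu).2 (hu v (Finset.mem_univ v)), ⟨u, div_self hzu.ne'⟩, fun v => ?_⟩
  have := hMz z v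
  rw [hzero] at this
  rw [← Finset.sum_div, ← mul_div_assoc]
  congr 1
  simp only [Pi.zero_apply] at this
  linarith

/-- Eigenvectors of a symmetric matrix for different eigenvalues are orthogonal, but `z` is not
orthogonal to a Perron vector. -/
theorem rho_eq_of_pos [Nonempty V] {z : V → ℝ} {r : ℝ} (hz : ∀ v, 0 < z v)
    (h : ∀ v, ∑ w ∈ G.neighborFinset v, z w = r * z v) : G.rho = r := by
  obtain ⟨y, hy, -, ⟨u, hu⟩, hyv⟩ := G.exists_perron_vector
  have hpos : 0 < ∑ v, z v * y v :=
    Finset.sum_pos' (fun v _ => mul_nonneg (hz v).le (hy v))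
      ⟨u, Finset.mem_univ u, by rw [hu, mul_one]; exact hz u⟩
  have hsymm : ∑ v, ∑ w ∈ G.neighborFinset v, z v * y w =
      ∑ w, ∑ v ∈ G.neighborFinset w, z v * y w :=
    Finset.sum_comm' (by simp [G.adj_comm])
  have h1 : ∑ v, ∑ w ∈ G.neighborFinset v, z v * y w = G.rho * ∑ v, z v * y v := by
    rw [Finset.mul_sum]
    refine Finset.sum_congr rfl fun v _ => ?_
    rw [← Finset.mul_sum, hyv]
    ring
  have h2 : ∑ w, ∑ v ∈ G.neighborFinset w, z v * y w = r * ∑ v, z v * y v := by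
    rw [Finset.mul_sum]
    refine Finset.sum_congr rfl fun v _ => ?_
    rw [← Finset.sum_mul, h]
    ring
  exact mul_right_cancel₀ hpos.ne' (h1.symm.trans (hsymm.trans h2))

variable {G}

open Classical in
theorem rho_eq_of_iso [Nonempty V] {W : Type*} [Fintype W] {H : SimpleGraph W} (φ : G ≃g H)
    {z : W → ℝ} {r : ℝ} (hz : ∀ v, 0 < z v)
    (h : ∀ v, (∑ w, if H.Adj v w then z w else 0) = r * z v) : G.rho = r := by
  refine G.rho_eq_of_pos (z := fun v => z (φ v)) (fun v => hz _) fun v => ?_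
  rw [← h (φ v), ← φ.toEquiv.sum_comp, ← Finset.sum_filter]
  refine Finset.sum_congr ?_ fun _ _ => rfl
  ext w
  simpa using φ.map_adj_iff.symm

theorem rho_of_iso_completeBipartiteGraph_two {n : ℕ} (hn : 0 < n)
    (φ : G ≃g completeBipartiteGraph (Fin 2) (Fin n)) : G.rho = √(2 * n) := by
  have : Nonempty V := ⟨φ.symm (Sum.inl 0)⟩
  have hn' : (0 : ℝ) < n := by exact_mod_cast hn
  have h2 := Real.mul_self_sqrt (zero_le_two (α := ℝ))
  have h3 := Real.mul_self_sqrt hn'.le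
  have h4 : √(2 * n : ℝ) = √2 * √n := Real.sqrt_mul zero_le_two _
  refine rho_eq_of_iso φ (z := Sum.elim (fun _ => √n) fun _ => √2) ?_ ?_
  · rintro (i | i)
    · exact Real.sqrt_pos.2 hn'
    · exact Real.sqrt_pos.2 two_pos
  · rintro (i | i)
    · simp [h4]
      linear_combination (-√2) * h3
    · simp [h4]
      linear_combination (-√n) * h2

theorem rho_of_iso_subdivideEdge {n : ℕ} {e : Sym2 (Fin 2 ⊕ Fin n)}
    (he : e ∈ (completeBipartiteGraph (Fin 2) (Fin n)).edgeSet)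
    (φ : G ≃g (completeBipartiteGraph (Fin 2) (Fin n)).subdivideEdge e) {r : ℝ} (hr : 1 < r)
    (h : (r - 1) * (r ^ 2 - (2 * n - 1)) = 1) : G.rho = r := by
  classical
  have : Nonempty V := ⟨φ.symm none⟩
  obtain ⟨i, j, rfl⟩ : ∃ i j, e = s(Sum.inl i, Sum.inr j) := by
    induction e with
    | _ p q =>
      rcases p with i | i <;> rcases q with j | j <;> simp at he
      · exact ⟨i, j, rfl⟩
      · exact ⟨j, i, Sym2.eq_swap⟩
  -- The weights solve the eigenvalue equations outwards from the side of size two, given weight r(r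
  -- − 1). The equations at that side itself then amount to `h`.
  refine rho_eq_of_iso φ (r := r) (z := fun o => o.elim r (Sum.elim (fun _ => r * (r - 1))
    fun k => if k = j then r else 2 * (r - 1))) ?_ ?_
  · rintro (_ | k | k)
    · simp; linarith
    · simp; nlinarith
    · simp; split_ifs <;> linarith
  · have hsum : ∀ c d : ℝ, (∑ k : Fin n, if k = j then c else d) = c + (n - 1) * d := by
      intro c d
      have : ∀ k : Fin n, (if k = j then c else d) = d + if k = j then c - d else 0 := by
        intro k; split_ifs <;> ring
      simp only [this, Finset.sum_add_distrib, Finset.sum_const, Finset.card_univ,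
        Fintype.card_fin, nsmul_eq_mul, Finset.sum_ite_eq', Finset.mem_univ, if_true]
      ring
    rintro (_ | k | k)
    · simp [Fintype.sum_option, subdivideEdge]
      ring
    · by_cases hk : k = i
      · subst hk
        have hite : ∀ x : Fin n, (if x = j then 0 else if x = j then r else 2 * (r - 1)) =
            if x = j then 0 else 2 * (r - 1) := fun x => by split_ifs <;> rfl
        simp only [Fintype.sum_option, Fintype.sum_sum_type, subdivideEdge]
        simp [hite]
        rw [hsum]
        linear_combination -h
      · simp [Fintype.sum_option, subdivideEdge, hk]
        rw [hsum]
        linear_combination -h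
    · by_cases hk : k = j
      · subst hk
        simp [Fintype.sum_option, subdivideEdge]
        fin_cases i <;> simp <;> ring
      · simp [Fintype.sum_option, subdivideEdge, hk]
        ring

end SimpleGraph

/-! ### Walks of length two from a vertex of maximum Perron weight. -/

namespace SimpleGraph

variable {V : Type*} [Fintype V] [DecidableEq V] {G : SimpleGraph V} [DecidableRel G.Adj]

/-- Walks of length two from `u`, grouped by endpoint: `d(u)` return to `u`, none end at a neighbour
since there are no triangles, and those ending at `w` correspond to common neighbours. -/
theorem sum_sum_neighborFinset_of_triangleFree
    (hT : ∀ x y z, G.Adj x y → G.Adj y z → ¬ G.Adj x z) (u : V) (f : V → ℝ) :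
    ∑ v ∈ G.neighborFinset u, ∑ w ∈ G.neighborFinset v, f w =
      G.degree u * f u + ∑ w with w ≠ u ∧ ¬ G.Adj u w,
        (G.neighborFinset w ∩ G.neighborFinset u).card * f w := by
  have h1 : ∑ v ∈ G.neighborFinset u, ∑ w ∈ G.neighborFinset v, f w =
      ∑ w, ∑ v ∈ G.neighborFinset w ∩ G.neighborFinset u, f w :=
    Finset.sum_comm' (by simp [G.adj_comm, and_comm])
  simp only [h1, Finset.sum_const, nsmul_eq_mul]
  rw [← Finset.sum_subset (Finset.subset_univ
    (insert u (Finset.univ.filter fun w => w ≠ u ∧ ¬ G.Adj u w))), Finset.sum_insert (by simp)]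
  · simp
  · intro w _ hw
    simp only [Finset.mem_insert, Finset.mem_filter, Finset.mem_univ, true_and, not_or, not_and,
      not_not] at hw
    have : G.neighborFinset w ∩ G.neighborFinset u = ∅ := by
      ext v
      simpa using fun h1 h2 => hT u v w h2 h1.symm (hw.2 hw.1)
    simp [this]

/-- The handshake identity split over `u`, N(u) and `W`. The last term counts ordered pairs, so it
is twice the number of edges inside `W`. -/
theorem two_mul_card_edgeFinset_of_triangleFree
    (hT : ∀ x y z, G.Adj x y → G.Adj y z → ¬ G.Adj x z) (u : V) (W : Finset V)
    (hW : W = Finset.univ.filter fun w => w ≠ u ∧ ¬ G.Adj u w) :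
    2 * (G.edgeFinset.card : ℝ) = 2 * G.degree u +
      2 * ∑ w ∈ W, ((G.neighborFinset w ∩ G.neighborFinset u).card : ℝ) +
        ((W ×ˢ W).filter fun p => G.Adj p.1 p.2).card := by
  have h0 : (∑ v, (G.degree v : ℝ)) = 2 * (G.edgeFinset.card : ℝ) := by
    exact_mod_cast G.sum_degrees_eq_twice_card_edges
  have h1 : ∑ v, (G.degree v : ℝ) = G.degree u + ∑ v ∈ G.neighborFinset u, (G.degree v : ℝ) +
      ∑ v ∈ W, (G.degree v : ℝ) := by
    rw [← Finset.sum_insert (f := fun v => (G.degree v : ℝ)) (G.notMem_neighborFinset_self u),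
      ← Finset.sum_union]
    · refine Finset.sum_congr ?_ fun _ _ => rfl
      ext v
      simp [hW]
      tauto
    · rw [Finset.disjoint_left]
      intro v
      simp [hW]
      tauto
  have h2 : ∑ v ∈ G.neighborFinset u, (G.degree v : ℝ) = G.degree u +
      ∑ w ∈ W, ((G.neighborFinset w ∩ G.neighborFinset u).card : ℝ) := by
    have := sum_sum_neighborFinset_of_triangleFree hT u fun _ => 1
    simpa [hW] using this
  have h3 : (((W ×ˢ W).filter fun p => G.Adj p.1 p.2).card : ℝ) =
      ∑ w ∈ W, ((G.neighborFinset w ∩ W).card : ℝ) := by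
    rw [Finset.card_filter, Finset.sum_product]
    push_cast
    refine Finset.sum_congr rfl fun w _ => ?_
    rw [← Finset.sum_filter, Finset.sum_const, nsmul_eq_mul, mul_one]
    congr 2
    ext v
    simp [and_comm]
  have h4 : ∑ v ∈ W, (G.degree v : ℝ) =
      ∑ w ∈ W, ((G.neighborFinset w ∩ G.neighborFinset u).card : ℝ) +
        ∑ w ∈ W, ((G.neighborFinset w ∩ W).card : ℝ) := by
    rw [← Finset.sum_add_distrib]
    refine Finset.sum_congr rfl fun w hw => ?_
    rw [← Nat.cast_add, ← Finset.card_union_of_disjoint, ← G.card_neighborFinset_eq_degree]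
    · congr 2
      have hwu : ¬ G.Adj u w := by simp [hW] at hw; exact hw.2
      ext v
      simp only [mem_neighborFinset, hW, Finset.mem_union, Finset.mem_inter, Finset.mem_filter,
        Finset.mem_univ, true_and]
      have : G.Adj w v → v ≠ u := by rintro h rfl; exact hwu h.symm
      tauto
    · rw [Finset.disjoint_left]
      intro v
      simp [hW]
      tauto
  rw [h3]
  linarith

theorem rho_sq_eq_of_triangleFree (hT : ∀ x y z, G.Adj x y → G.Adj y z → ¬ G.Adj x z) {u : V}
    {y : V → ℝ} (hu : y u = 1) (hy : ∀ v, ∑ w ∈ G.neighborFinset v, y w = G.rho * y v) :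
    G.rho ^ 2 = G.degree u + ∑ w with w ≠ u ∧ ¬ G.Adj u w,
      (G.neighborFinset w ∩ G.neighborFinset u).card * y w := by
  have := sum_sum_neighborFinset_of_triangleFree hT u y
  rw [hu, mul_one] at this
  rw [← this]
  simp only [hy]
  rw [← Finset.mul_sum, hy, hu]
  ring

theorem rho_sq_le_of_triangleFree (hT : ∀ x y z, G.Adj x y → G.Adj y z → ¬ G.Adj x z) {u : V}
    {y : V → ℝ} (hu : y u = 1) (hy1 : ∀ v, y v ≤ 1)
    (hy : ∀ v, ∑ w ∈ G.neighborFinset v, y w = G.rho * y v) (W : Finset V)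
    (hW : W = Finset.univ.filter fun w => w ≠ u ∧ ¬ G.Adj u w) :
    G.rho ^ 2 ≤ G.edgeFinset.card - (((W ×ˢ W).filter fun p => G.Adj p.1 p.2).card : ℝ) / 2 := by
  have h1 := rho_sq_eq_of_triangleFree hT hu hy
  have h2 := two_mul_card_edgeFinset_of_triangleFree hT u W hW
  rw [← hW] at h1
  have h3 : ∑ w ∈ W, ((G.neighborFinset w ∩ G.neighborFinset u).card * y w : ℝ) ≤
      ∑ w ∈ W, ((G.neighborFinset w ∩ G.neighborFinset u).card : ℝ) :=
    Finset.sum_le_sum fun w _ => mul_le_of_le_one_right (Nat.cast_nonneg _) (hy1 w)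
  linarith

theorem IsMinimallyKConnected.exists_iso_of_no_adj_pair (hG : G.IsMinimallyKConnected 2)
    (hT : ∀ x y z, G.Adj x y → G.Adj y z → ¬ G.Adj x z) {u : V} (W : Finset V)
    (hW : W = Finset.univ.filter fun w => w ≠ u ∧ ¬ G.Adj u w)
    (h : ((W ×ˢ W).filter fun p => G.Adj p.1 p.2) = ∅) :
    ∃ n, Nonempty (G ≃g completeBipartiteGraph (Fin 2) (Fin n)) := by
  refine hG.nonempty_iso_of_nonneighbors_independent hT (u := u) fun a b ha hb hab => ?_
  have hau : a ≠ u := by rintro rfl; exact hb hab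
  have hbu : b ≠ u := by rintro rfl; exact ha hab.symm
  have : (a, b) ∈ (W ×ˢ W).filter fun p => G.Adj p.1 p.2 := by
    simp [hW, hau, hbu, ha, hb, hab]
  simp [h] at this

theorem exists_iso_subdivideEdge_of_two_nonneighbors
    (hT : ∀ x y z, G.Adj x y → G.Adj y z → ¬ G.Adj x z) {u a b : V}
    (hua : u ≠ a) (hub : u ≠ b) (hab : G.Adj a b)
    (hu : ∀ z, G.Adj u z ↔ z ≠ u ∧ z ≠ a ∧ z ≠ b)
    (hcover : ∀ z, G.Adj u z → G.Adj a z ∨ G.Adj b z)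
    (hone : (G.neighborFinset b ∩ G.neighborFinset u).card = 1) :
    ∃ e ∈ (completeBipartiteGraph (Fin 2) (Fin (G.degree u))).edgeSet,
      Nonempty (G ≃g (completeBipartiteGraph (Fin 2) (Fin (G.degree u))).subdivideEdge e) := by
  obtain ⟨q, hq⟩ := Finset.card_eq_one.1 hone
  have hqb : ∀ z, G.Adj b z ∧ G.Adj u z ↔ z = q := fun z => by
    have := Finset.ext_iff.1 hq z
    simpa using this
  have hbq := (hqb q).2 rfl
  have hnua : ¬ G.Adj u a := fun h => ((hu a).1 h).2.1 rfl
  have hnub : ¬ G.Adj u b := fun h => ((hu b).1 h).2.2 rfl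
  refine nonempty_iso_subdivideEdge hua hub hab.ne ((hu q).1 hbq.2) hu (fun z => ?_) (fun z => ?_)
    (fun v w huv huw hvw => hT u v w huv hvw huw) ?_
  · constructor
    · intro haz
      by_cases hzb : z = b
      · exact Or.inl hzb
      · have hzu : z ≠ u := by rintro rfl; exact hnua haz.symm
        refine Or.inr ⟨hzu, haz.ne', hzb, ?_⟩
        rintro rfl
        exact hT a b z hab hbq.1 haz
    · rintro (rfl | ⟨h1, h2, h3, h4⟩)
      · exact hab
      · have huz := (hu z).2 ⟨h1, h2, h3⟩
        exact (hcover z huz).resolve_right fun hbz => h4 ((hqb z).1 ⟨hbz, huz⟩)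
  · constructor
    · intro hbz
      by_cases hza : z = a
      · exact Or.inl hza
      · have hzu : z ≠ u := by rintro rfl; exact hnub hbz.symm
        exact Or.inr ((hqb z).1 ⟨hbz, (hu z).2 ⟨hzu, hza, hbz.ne'⟩⟩)
    · rintro (rfl | rfl)
      · exact hab.symm
      · exact hbq.1
  · exact Nat.subtype_card (G.neighborFinset u) (by simp [hu])

theorem IsMinimallyKConnected.rho_le_sqrt (hG : G.IsMinimallyKConnected 2)
    (hm : G.edgeFinset.card ≠ 3) : G.rho ≤ √(G.edgeFinset.card : ℝ) := by
  have := hG.1.nonempty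
  obtain ⟨y, -, hy1, ⟨u, hu⟩, hy⟩ := G.exists_perron_vector
  refine Real.le_sqrt_of_sq_le ?_
  have h := rho_sq_le_of_triangleFree (hG.triangleFree hm) hu hy1 hy _ rfl
  exact h.trans (sub_le_self _ (by positivity))

theorem IsMinimallyKConnected.exists_iso_of_rho_eq_sqrt (hG : G.IsMinimallyKConnected 2)
    (hm : G.edgeFinset.card ≠ 3) (h : G.rho = √(G.edgeFinset.card : ℝ)) :
    ∃ n, Nonempty (G ≃g completeBipartiteGraph (Fin 2) (Fin n)) := by
  have := hG.1.nonempty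
  obtain ⟨y, -, hy1, ⟨u, hu⟩, hy⟩ := G.exists_perron_vector
  have hle := rho_sq_le_of_triangleFree (hG.triangleFree hm) hu hy1 hy _ rfl
  rw [h, Real.sq_sqrt (Nat.cast_nonneg _)] at hle
  refine hG.exists_iso_of_no_adj_pair (hG.triangleFree hm) (u := u) _ rfl ?_
  rw [← Finset.card_eq_zero, ← Nat.cast_eq_zero (R := ℝ)]
  exact le_antisymm (by linarith) (Nat.cast_nonneg _)

end SimpleGraph

/-! ### Odd size: tightness in the cubic inequality forces SK_{2,n}. -/

namespace SimpleGraph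

variable {V : Type*} [Fintype V] [DecidableEq V] {G : SimpleGraph V} [DecidableRel G.Adj]

theorem IsMinimallyKConnected.exists_iso_subdivideEdge_of_one_le
    (hG : G.IsMinimallyKConnected 2) (hodd : Odd G.edgeFinset.card) (hm : G.edgeFinset.card ≠ 3)
    (hρ : 2 < G.rho) (h : 1 ≤ (G.rho - 1) * (G.rho ^ 2 - (G.edgeFinset.card - 2))) :
    ∃ e ∈ (completeBipartiteGraph (Fin 2) (Fin ((G.edgeFinset.card - 1) / 2))).edgeSet,
      Nonempty (G ≃g
        (completeBipartiteGraph (Fin 2) (Fin ((G.edgeFinset.card - 1) / 2))).subdivideEdge e) := by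
  have hV := hG.1.nonempty
  have hT := hG.triangleFree hm
  obtain ⟨y, hy0, hy1, ⟨u, hu⟩, hy⟩ := G.exists_perron_vector
  set W : Finset V := Finset.univ.filter fun w => w ≠ u ∧ ¬ G.Adj u w with hW
  have hWmem : ∀ w, w ∈ W ↔ w ≠ u ∧ ¬ G.Adj u w := fun w => by simp [hW]
  set D := (W ×ˢ W).filter fun p => G.Adj p.1 p.2 with hD
  have hDmem : ∀ c d, (c, d) ∈ D ↔ (c ∈ W ∧ d ∈ W) ∧ G.Adj c d := fun c d => by simp [hD]
  have hcard := two_mul_card_edgeFinset_of_triangleFree hT u W hW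
  have hle := rho_sq_le_of_triangleFree hT hu hy1 hy W hW
  have hsq := rho_sq_eq_of_triangleFree hT hu hy
  rw [← hW] at hsq
  rw [← hD] at hle hcard
  set m := G.edgeFinset.card with hmdef
  -- Two edges inside `W` would give ρ² ≤ m − 2, making the product in `h` nonpositive.
  have hD4 : D.card < 4 := by
    by_contra! h4
    have h4' : (4 : ℝ) ≤ D.card := by exact_mod_cast h4
    nlinarith
  obtain ⟨⟨a, b⟩, habD⟩ : D.Nonempty := by
    rw [Finset.nonempty_iff_ne_empty]
    intro hempty
    obtain ⟨n, hn⟩ := hG.exists_iso_of_no_adj_pair hT W hW hempty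
    have := card_edgeFinset_of_iso_completeBipartiteGraph_two hn
    rw [← hmdef] at this
    exact (Nat.not_even_iff_odd.2 hodd) (this ▸ even_two_mul n)
  obtain ⟨⟨haW, hbW⟩, hab⟩ := (hDmem a b).1 habD
  have hDeq : D = {(a, b), (b, a)} := by
    refine Finset.Subset.antisymm ?_ ?_
    · rintro ⟨c, d⟩ hcd
      by_contra hne
      obtain ⟨⟨hcW, hdW⟩, hcd'⟩ := (hDmem c d).1 hcd
      have hsub : ({(a, b), (b, a), (c, d), (d, c)} : Finset (V × V)) ⊆ D := by
        intro p
        simp only [Finset.mem_insert, Finset.mem_singleton]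
        rintro (rfl | rfl | rfl | rfl) <;> rw [hDmem]
        exacts [⟨⟨haW, hbW⟩, hab⟩, ⟨⟨hbW, haW⟩, hab.symm⟩, ⟨⟨hcW, hdW⟩, hcd'⟩,
          ⟨⟨hdW, hcW⟩, hcd'.symm⟩]
      have hc4 : ({(a, b), (b, a), (c, d), (d, c)} : Finset (V × V)).card = 4 := by
        have := hab.ne
        have := hcd'.ne
        simp only [Finset.mem_insert, Finset.mem_singleton, Prod.mk.injEq, not_or, not_and] at hne
        rw [Finset.card_insert_of_notMem, Finset.card_insert_of_notMem,
          Finset.card_insert_of_notMem, Finset.card_singleton]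
        all_goals
          simp only [Finset.mem_insert, Finset.mem_singleton, Prod.mk.injEq, not_or, not_and]
          grind
      have := Finset.card_le_card hsub
      omega
    · intro p
      simp only [Finset.mem_insert, Finset.mem_singleton]
      rintro (rfl | rfl) <;> rw [hDmem]
      exacts [⟨⟨haW, hbW⟩, hab⟩, ⟨⟨hbW, haW⟩, hab.symm⟩]
  have hD2 : (D.card : ℝ) = 2 := by
    rw [hDeq, Finset.card_pair (by simp [hab.ne])]
    norm_num
  have hWadj : ∀ c d, c ∈ W → d ∈ W → G.Adj c d → (c = a ∧ d = b) ∨ (c = b ∧ d = a) := by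
    intro c d hc hd hcd
    have := (hDmem c d).2 ⟨⟨hc, hd⟩, hcd⟩
    simpa [hDeq] using this
  set N := G.neighborFinset u with hN
  set C : V → Finset V := fun w => G.neighborFinset w ∩ N with hC
  have hCmem : ∀ w v, v ∈ C w ↔ G.Adj w v ∧ G.Adj u v := fun w v => by simp [hC, hN]
  obtain ⟨hau, hnua⟩ := (hWmem a).1 haW
  obtain ⟨hbu, hnub⟩ := (hWmem b).1 hbW
  have hC1 : ∀ w ∈ W, (1 : ℝ) ≤ (C w).card := by
    intro w hw
    obtain ⟨hwu, hnuw⟩ := (hWmem w).1 hw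
    -- The excluded vertex is the only possible neighbour of `w` inside `W`; for `w` other than `a`
    -- and `b` the choice is immaterial.
    obtain ⟨v, hwv, hv⟩ := hG.1.exists_adj_ne w (if w = a then b else a)
    have hvu : v ≠ u := by rintro rfl; exact hnuw hwv.symm
    have huv : G.Adj u v := by
      by_contra huv
      rcases hWadj w v hw ((hWmem v).2 ⟨hvu, huv⟩) hwv with ⟨rfl, rfl⟩ | ⟨rfl, rfl⟩
      · simp at hv
      · rw [if_neg hab.ne'] at hv
        exact hv rfl
    exact_mod_cast Finset.card_pos.2 ⟨v, (hCmem w v).2 ⟨hwv, huv⟩⟩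
  have hnbr : ∀ c d, c ∈ W → d ∈ W → G.Adj c d → G.neighborFinset c = insert d (C c) := by
    intro c d hc hd hcd
    ext v
    simp only [mem_neighborFinset, Finset.mem_insert, hCmem]
    refine ⟨fun hcv => ?_, ?_⟩
    · by_cases huv : G.Adj u v
      · exact Or.inr ⟨hcv, huv⟩
      · left
        have hvu : v ≠ u := by rintro rfl; exact ((hWmem c).1 hc).2 hcv.symm
        have h1 := hWadj c v hc ((hWmem v).2 ⟨hvu, huv⟩) hcv
        have h2 := hWadj c d hc hd hcd
        have := hab.ne
        grind
    · rintro (rfl | h)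
      exacts [hcd, h.1]
  have hya : y b + ∑ v ∈ C a, y v = G.rho * y a := by
    rw [← hy a, hnbr a b haW hbW hab, Finset.sum_insert (by simp [hCmem, hnub])]
  have hyb : y a + ∑ v ∈ C b, y v = G.rho * y b := by
    rw [← hy b, hnbr b a hbW haW hab.symm, Finset.sum_insert (by simp [hCmem, hnua])]
  have hyu : ∑ v ∈ N, y v = G.rho := by rw [hy u, hu, mul_one]
  have hdisj : Disjoint (C a) (C b) := by
    rw [Finset.disjoint_left]
    intro v hva hvb
    rw [hCmem] at hva hvb
    exact hT a b v hab hvb.1 hva.1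
  have hCN : ∀ w, C w ⊆ N := fun w => Finset.inter_subset_right
  set R := ∑ v ∈ N \ (C a ∪ C b), y v with hR
  have hRsum : R + (∑ v ∈ C a, y v + ∑ v ∈ C b, y v) = G.rho := by
    rw [← Finset.sum_union hdisj, hR, Finset.sum_sdiff (Finset.union_subset (hCN a) (hCN b)), hyu]
  have hR0 : 0 ≤ R := Finset.sum_nonneg fun v _ => hy0 v
  set W' := (W.erase a).erase b with hW'
  have hWsum : ∀ f : V → ℝ, ∑ w ∈ W, f w = f a + f b + ∑ w ∈ W', f w := by
    intro f
    rw [hW', ← Finset.add_sum_erase W f haW,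
      ← Finset.add_sum_erase (W.erase a) f (Finset.mem_erase.2 ⟨hab.ne', hbW⟩)]
    ring
  set S' := ∑ w ∈ W', ((C w).card : ℝ) * (1 - y w) with hS'
  have hS'nn : ∀ w ∈ W', 0 ≤ ((C w).card : ℝ) * (1 - y w) := fun w _ =>
    mul_nonneg (Nat.cast_nonneg _) (sub_nonneg.2 (hy1 w))
  have hS'0 : 0 ≤ S' := Finset.sum_nonneg hS'nn
  have hdef : (m : ℝ) - 1 - G.rho ^ 2 =
      (C a).card * (1 - y a) + (C b).card * (1 - y b) + S' := by
    have : ∑ w ∈ W, ((C w).card : ℝ) * (1 - y w) =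
        ∑ w ∈ W, ((C w).card : ℝ) - ∑ w ∈ W, ((C w).card : ℝ) * y w := by
      rw [← Finset.sum_sub_distrib]
      exact Finset.sum_congr rfl fun w _ => by ring
    rw [hWsum fun w => ((C w).card : ℝ) * (1 - y w)] at this
    linarith
  have hca := hC1 a haW
  have hcb := hC1 b hbW
  have hka : 0 ≤ ((C a).card - 1 : ℝ) * (1 - y a) :=
    mul_nonneg (by linarith) (sub_nonneg.2 (hy1 a))
  have hkb : 0 ≤ ((C b).card - 1 : ℝ) * (1 - y b) :=
    mul_nonneg (by linarith) (sub_nonneg.2 (hy1 b))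
  have hρ1 : 0 < G.rho - 1 := by linarith
  -- Here `h1` adds the equations at `a`, `b` and `u`. Substituting it in `h` leaves a sum of
  -- nonnegative terms that is at most 0, so each vanishes.
  have htight : (G.rho - 1) * (((C a).card - 1 : ℝ) * (1 - y a) +
      ((C b).card - 1 : ℝ) * (1 - y b) + S') + R ≤ 0 := by
    have h1 : (G.rho - 1) * (y a + y b) = G.rho - R := by linarith
    have h2 : G.rho ^ 2 - (m - 2) = 1 - (((C a).card - 1 : ℝ) * (1 - y a) +
      ((C b).card - 1 : ℝ) * (1 - y b) + S') - (2 - (y a + y b)) := by linarith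
    rw [h2] at h
    linarith
  have hsum0 : 0 ≤ (G.rho - 1) * (((C a).card - 1 : ℝ) * (1 - y a) +
      ((C b).card - 1 : ℝ) * (1 - y b) + S') := mul_nonneg hρ1.le (by linarith)
  have hReq : R = 0 := by linarith
  have hall : ((C a).card - 1 : ℝ) * (1 - y a) + ((C b).card - 1 : ℝ) * (1 - y b) + S' = 0 := by
    have : (G.rho - 1) * (((C a).card - 1 : ℝ) * (1 - y a) +
      ((C b).card - 1 : ℝ) * (1 - y b) + S') = 0 := by linarith
    exact (mul_eq_zero.1 this).resolve_left hρ1.ne'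
  -- The eigenvalue equation at a neighbour of `u` gives ρ y(v) ≥ y(u) = 1.
  have hypos : ∀ v ∈ N, 0 < y v := by
    intro v hv
    have huv : G.Adj u v := by simpa [hN] using hv
    have h1 : y u ≤ ∑ w ∈ G.neighborFinset v, y w :=
      Finset.single_le_sum (fun w _ => hy0 w) (by simpa using huv.symm)
    rw [hy v, hu] at h1
    by_contra! hv0
    nlinarith
  have hempty : ∀ M ⊆ N, ∑ v ∈ M, y v = 0 → M = ∅ := by
    intro M hM hsum
    by_contra hne
    exact (Finset.sum_pos (fun v hv => hypos v (hM hv))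
      (Finset.nonempty_iff_ne_empty.2 hne)).ne' hsum
  have hNeq : N = C a ∪ C b :=
    Finset.Subset.antisymm (Finset.sdiff_eq_empty_iff_subset.1
      (hempty _ Finset.sdiff_subset hReq)) (Finset.union_subset (hCN a) (hCN b))
  have hcover : ∀ z, G.Adj u z → G.Adj a z ∨ G.Adj b z := by
    intro z hz
    have : z ∈ N := by simpa [hN] using hz
    rw [hNeq, Finset.mem_union, hCmem, hCmem] at this
    tauto
  -- A further `w` in `W` would have weight 1, hence be adjacent to all of N(u). With `p` in C(a),
  -- `q` in C(b) and a third `v` in N(u), say adjacent to `a`, the edge av then has the disjoint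
  -- detours a–p–w–v and a–b–q–u–v.
  have hW'empty : W' = ∅ := by
    rw [Finset.eq_empty_iff_forall_notMem]
    intro w hw'
    obtain ⟨hwb, hwa, hw⟩ : w ≠ b ∧ w ≠ a ∧ w ∈ W := by simpa [hW'] using hw'
    obtain ⟨hwu, hnuw⟩ := (hWmem w).1 hw
    have h0 : ((C w).card : ℝ) * (1 - y w) = 0 :=
      (Finset.sum_eq_zero_iff_of_nonneg hS'nn).1 (by linarith) w hw'
    have hyw : y w = 1 := by
      have := (mul_eq_zero.1 h0).resolve_left (by linarith [hC1 w hw])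
      linarith
    have hnw : G.neighborFinset w = C w := by
      ext v
      rw [hCmem, mem_neighborFinset]
      refine ⟨fun hwv => ⟨hwv, by_contra fun huv => ?_⟩, fun h => h.1⟩
      have hvu : v ≠ u := by rintro rfl; exact hnuw hwv.symm
      have := hWadj w v hw ((hWmem v).2 ⟨hvu, huv⟩) hwv
      tauto
    have hwN : ∀ v, G.Adj u v → G.Adj w v := by
      intro v hv
      have h1 : ∑ v ∈ N \ C w, y v = 0 := by
        have := Finset.sum_sdiff (f := y) (hCN w)
        rw [hyu, ← hnw, hy w, hyw] at this
        rw [← hnw]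
        linarith
      have h2 := Finset.sdiff_eq_empty_iff_subset.1 (hempty _ Finset.sdiff_subset h1)
      exact ((hCmem w v).1 (h2 (by simpa [hN] using hv))).1
    obtain ⟨p, hp⟩ := Finset.card_pos.1 (show 0 < (C a).card by
      exact_mod_cast lt_of_lt_of_le one_pos hca)
    obtain ⟨q, hq⟩ := Finset.card_pos.1 (show 0 < (C b).card by
      exact_mod_cast lt_of_lt_of_le one_pos hcb)
    have hpq : p ≠ q := fun h => Finset.disjoint_left.1 hdisj hp (h ▸ hq)
    rw [hCmem] at hp hq
    -- The weights on N(u) sum to ρ > 2 and are at most 1 each, so N(u) has a third vertex.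
    obtain ⟨v, huv, hvp, hvq⟩ : ∃ v, G.Adj u v ∧ v ≠ p ∧ v ≠ q := by
      by_contra! hno
      have hsub : N ⊆ {p, q} := fun v hv => by
        have hv' : G.Adj u v := by simpa [hN] using hv
        have := hno v hv'
        simp only [Finset.mem_insert, Finset.mem_singleton]
        tauto
      have := Finset.sum_le_sum_of_subset_of_nonneg hsub fun v _ _ => hy0 v
      rw [hyu, Finset.sum_pair hpq] at this
      linarith [hy1 p, hy1 q]
    have key : ∀ a b p q, a ≠ u → b ≠ u → ¬ G.Adj u a → ¬ G.Adj u b → w ≠ a → w ≠ b →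
        G.Adj a b → G.Adj a p ∧ G.Adj u p → G.Adj b q ∧ G.Adj u q → p ≠ q → v ≠ p → v ≠ q →
        G.Adj a v → False := by
      intro a b p q hau hbu hnua hnub hwa hwb hab hp hq hpq hvp hvq hav
      refine hG.two_paths_three_four hav hp.1 (hwN p hp.2).symm (hwN v huv) hab hq.1 hq.2.symm
        huv ?_ hpq hp.2.ne' hwb ?_ hwu hvp.symm ?_ hwa ?_ hau.symm
      · rintro rfl; exact hnub hp.2
      · rintro rfl; exact hnuw hq.2
      · rintro rfl; exact hnub huv
      · rintro rfl; exact hnua hq.2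
    rcases hcover v huv with hav | hbv
    · exact key a b p q hau hbu hnua hnub hwa hwb hab hp hq hpq hvp hvq hav
    · exact key b a q p hbu hau hnub hnua hwb hwa hab.symm hq hp hpq.symm hvq hvp hbv
  have huadj : ∀ z, G.Adj u z ↔ z ≠ u ∧ z ≠ a ∧ z ≠ b := by
    intro z
    refine ⟨?_, fun ⟨hzu, hza, hzb⟩ => by_contra fun hz => ?_⟩
    · rintro hz
      refine ⟨hz.ne', ?_, ?_⟩ <;> rintro rfl <;> contradiction
    · have : z ∈ W' := by simp [hW', hza, hzb, hWmem, hzu, hz]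
      simp [hW'empty] at this
  have hm2 : (m - 1) / 2 = G.degree u := by
    have h1 : (G.degree u : ℝ) = (C a).card + (C b).card := by
      rw [← G.card_neighborFinset_eq_degree, ← hN, hNeq, Finset.card_union_of_disjoint hdisj]
      push_cast
      rfl
    have h2 : (m : ℝ) = 2 * G.degree u + 1 := by
      have := hWsum fun w => ((C w).card : ℝ)
      rw [hW'empty, Finset.sum_empty] at this
      linarith
    have h3 : m = 2 * G.degree u + 1 := by exact_mod_cast h2
    omega
  rw [hm2]
  -- Weight 1 at both `a` and `b` would give 2(ρ − 1) = ρ, contradicting ρ > 2. An endpoint of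
  -- smaller weight has exactly one common neighbour with `u` and becomes the subdividing vertex.
  by_cases hya1 : y a = 1
  · have hyb1 : y b ≠ 1 := by
      intro hyb1
      have : (G.rho - 1) * (y a + y b) = G.rho - R := by linarith
      rw [hya1, hyb1] at this
      linarith
    have h1 : ((C b).card - 1 : ℝ) * (1 - y b) = 0 := by linarith
    have h2 := (mul_eq_zero.1 h1).resolve_right (sub_ne_zero.2 (Ne.symm hyb1))
    have h3 : ((C b).card : ℝ) = 1 := by linarith
    exact exists_iso_subdivideEdge_of_two_nonneighbors hT hau.symm hbu.symm hab huadj hcover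
      (by exact_mod_cast h3)
  · have h1 : ((C a).card - 1 : ℝ) * (1 - y a) = 0 := by linarith
    have h2 := (mul_eq_zero.1 h1).resolve_right (sub_ne_zero.2 (Ne.symm hya1))
    have h3 : ((C a).card : ℝ) = 1 := by linarith
    exact exists_iso_subdivideEdge_of_two_nonneighbors hT hbu.symm hau.symm hab.symm
      (fun z => by rw [huadj]; tauto) (fun z hz => (hcover z hz).symm) (by exact_mod_cast h3)

end SimpleGraph

/-! ### The largest root of the cubic, and the theorem. -/

theorem exists_isGreatest_cubic_root {m : ℝ} (hm : 6 < m) :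
    ∃ r : ℝ, IsGreatest {x : ℝ | x ^ 3 - x ^ 2 - (m - 2) * x + m - 3 = 0} r ∧ 2 < r ∧
      (r - 1) * (r ^ 2 - (m - 2)) = 1 ∧
      ∀ x, r ≤ x → 1 ≤ (x - 1) * (x ^ 2 - (m - 2)) := by
  have hf : ∀ x : ℝ, x ^ 3 - x ^ 2 - (m - 2) * x + m - 3 = (x - 1) * (x ^ 2 - (m - 2)) - 1 :=
    fun x => by ring
  have h4 : √(4 : ℝ) = 2 := by
    rw [show (4 : ℝ) = 2 ^ 2 by norm_num, Real.sqrt_sq zero_le_two]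
  have hs2 : 2 < √(m - 2) := h4 ▸ Real.sqrt_lt_sqrt (by norm_num) (by linarith)
  have hs := Real.sq_sqrt (show 0 ≤ m - 2 by linarith)
  have ht := Real.sq_sqrt (show 0 ≤ m - 1 by linarith)
  have hst : √(m - 2) ≤ √(m - 1) := Real.sqrt_le_sqrt (by linarith)
  have hcont : ContinuousOn (fun x : ℝ => (x - 1) * (x ^ 2 - (m - 2))) (Set.Icc √(m - 2) √(m - 1)) :=
    by fun_prop
  -- The product is 0 at √(m − 2) and √(m − 1) − 1 ≥ 1 at √(m − 1).
  obtain ⟨r, ⟨hr1, -⟩, hr⟩ := intermediate_value_Icc hst hcont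
    (show (1 : ℝ) ∈ Set.Icc _ _ by constructor <;> simp only [hs, ht] <;> linarith)
  simp only at hr
  -- The exact increment of the product from `r` to `x`, less the nonnegative term (x − r)²(x + r).
  -- It shows that no root lies beyond `r`.
  have hmono : ∀ x, r ≤ x → 1 + (x - r) * (r ^ 2 - (m - 2) + (r - 1) * (x + r)) ≤
      (x - 1) * (x ^ 2 - (m - 2)) := by
    intro x hx
    have : 0 ≤ (x - r) ^ 2 * (x + r) := mul_nonneg (sq_nonneg _) (by linarith)
    nlinarith
  have hr2 : m - 2 ≤ r ^ 2 := hs ▸ pow_le_pow_left₀ (Real.sqrt_nonneg _) hr1 2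
  have hslope : ∀ x, r ≤ x → 0 < r ^ 2 - (m - 2) + (r - 1) * (x + r) := fun x hx =>
    add_pos_of_nonneg_of_pos (by linarith) (mul_pos (by linarith) (by linarith))
  refine ⟨r, ⟨?_, fun x hx => ?_⟩, by linarith, hr, fun x hx => ?_⟩
  · show _ = _
    rw [hf, hr, sub_self]
  · have hx' : x ^ 3 - x ^ 2 - (m - 2) * x + m - 3 = 0 := hx
    rw [hf] at hx'
    by_contra! hlt
    have h1 := hmono x hlt.le
    have h2 := mul_pos (sub_pos.2 hlt) (hslope x hlt.le)
    linarith
  · have h1 := hmono x hx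
    have h2 := mul_nonneg (sub_nonneg.2 hx) (hslope x hx).le
    linarith

theorem theorem1p1 {V : Type*} [Fintype V] [DecidableEq V] (G : SimpleGraph V)
    [DecidableRel G.Adj] (m : ℕ) (hG : G.IsMinimallyKConnected 2) (hm : G.edgeFinset.card = m) :
    (Even m →
      G.rho ≤ √(m : ℝ) ∧
      (G.rho = √(m : ℝ) ↔ Nonempty (G ≃g completeBipartiteGraph (Fin 2) (Fin (m / 2))))) ∧
    (Odd m → 9 ≤ m →
      ∃ r : ℝ, IsGreatest {x : ℝ | x ^ 3 - x ^ 2 - ((m : ℝ) - 2) * x + (m : ℝ) - 3 = 0} r ∧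
        G.rho ≤ r ∧
        (G.rho = r ↔
          ∃ e ∈ (completeBipartiteGraph (Fin 2) (Fin ((m - 1) / 2))).edgeSet,
            Nonempty (G ≃g
              (completeBipartiteGraph (Fin 2) (Fin ((m - 1) / 2))).subdivideEdge e))) := by
  subst hm
  refine ⟨fun heven => ?_, fun hodd h9 => ?_⟩
  · have hm3 : G.edgeFinset.card ≠ 3 := fun h => by rw [h] at heven; exact absurd heven (by decide)
    refine ⟨hG.rho_le_sqrt hm3, fun h => ?_, fun ⟨φ⟩ => ?_⟩
    · obtain ⟨n, hn⟩ := hG.exists_iso_of_rho_eq_sqrt hm3 h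
      have hcard := SimpleGraph.card_edgeFinset_of_iso_completeBipartiteGraph_two hn
      rwa [show G.edgeFinset.card / 2 = n by omega]
    · have hcard := Nat.two_mul_div_two_of_even heven
      obtain ⟨v⟩ := hG.1.nonempty
      obtain ⟨w, hvw, -⟩ := hG.1.exists_adj_ne v v
      have hpos : 0 < G.edgeFinset.card :=
        Finset.card_pos.2 ⟨s(v, w), G.mem_edgeFinset.2 hvw⟩
      rw [SimpleGraph.rho_of_iso_completeBipartiteGraph_two (by omega) φ]
      congr 1
      exact_mod_cast hcard
  · obtain ⟨r, hr, hr2, hreq, hge⟩ :=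
      exists_isGreatest_cubic_root (m := G.edgeFinset.card) (by
        have : (9 : ℝ) ≤ G.edgeFinset.card := by exact_mod_cast h9
        linarith)
    have hiso : r ≤ G.rho →
        ∃ e ∈ (completeBipartiteGraph (Fin 2) (Fin ((G.edgeFinset.card - 1) / 2))).edgeSet,
          Nonempty (G ≃g (completeBipartiteGraph (Fin 2)
            (Fin ((G.edgeFinset.card - 1) / 2))).subdivideEdge e) := fun h =>
      hG.exists_iso_subdivideEdge_of_one_le hodd (by omega) (by linarith) (hge _ h)
    have hrho : (∃ e ∈ (completeBipartiteGraph (Fin 2)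
        (Fin ((G.edgeFinset.card - 1) / 2))).edgeSet, Nonempty (G ≃g (completeBipartiteGraph (Fin 2)
          (Fin ((G.edgeFinset.card - 1) / 2))).subdivideEdge e)) → G.rho = r := by
      rintro ⟨e, he, ⟨φ⟩⟩
      refine SimpleGraph.rho_of_iso_subdivideEdge he φ (by linarith) ?_
      have h1 : 2 * ((G.edgeFinset.card - 1) / 2) + 1 = G.edgeFinset.card := by
        obtain ⟨k, hk⟩ := hodd
        omega
      have h2 : 2 * (((G.edgeFinset.card - 1) / 2 : ℕ) : ℝ) + 1 = G.edgeFinset.card := by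
        exact_mod_cast h1
      linear_combination hreq - (r - 1) * h2
    refine ⟨r, hr, ?_, fun h => hiso h.ge, hrho⟩
    -- Exceeding `r` already forces SK_{2,n}, whose spectral radius is `r`; the bound thus follows
    -- from the equality case.
    by_contra! hlt
    exact hlt.ne' (hrho (hiso hlt.le))
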